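/- Let $\mathbb{F}_q$ be a finite field of characteristic $p$, let $\overline{\mathbb{F}_q}$ be its algebraic closure, let $0 \le k \le n$ be integers, let $S \subseteq \mathbb{F}_q^n$, and for every $a \in S$ let $\mathcal{C}(a) \subseteq \mathbb{F}_q^n$ be an $\mathbb{F}_q$-linear code of dimension $k$. For an affine variety $Y \subseteq \overline{\mathbb{F}_q}^n$ and a point $a \in Y \cap \mathbb{F}_q^n$, let $$T_a(Y,\mathbb{F}_q) = \Big\{ v \in \mathbb{F}_q^n \;:\; \sum_{j=1}^n \frac{\partial f}{\partial x_j}(a)\, v_j = 0 \text{ for all } f \in \mathbb{F}_q[x_1,\dots,x_n] \text{ vanishing on } Y \Big\}$$ be the Zariski tangent space, and let $T_a(Y,\overline{\mathbb{F}_q})$ be defined in the same way with $\overline{\mathbb{F}_q}$ in place of $\mathbb{F}_q$. A point $a$ of an irreducible variety $Y$ is smooth if $\dim T_a(Y,\overline{\mathbb{F}_q}) = \dim Y$, and $Y$ is defined over $\mathbb{F}_q$ if the ideal of all polynomials over $\overline{\mathbb{F}_q}$ vanishing on $Y$ is generated by polynomials with coefficients in $\mathbb{F}_q$. Irreducibility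 is meant over $\overline{\mathbb{F}_q}$. (i) There exist finitely many irreducible $k$-dimensional affine varieties $Y_1,\dots,Y_s \subseteq \overline{\mathbb{F}_q}^n$ defined over $\mathbb{F}_q$ such that $\mathbb{F}_q^n \subseteq Y_1 \cup \dots \cup Y_s$, every $a \in S$ is a smooth point of some $Y_i$, and $T_a(Y_i,\mathbb{F}_q) = \mathcal{C}(a)$ for all $a \in S$ and all $i$ with $a \in Y_i$. (ii) Such varieties are given by explicit equations, as follows. For every $a\in S$ let $\mathcal{H}(a)$ be any $(n-k)\times n$ parity check matrix of $\mathcal{C}(a)$ over $\mathbb{F}_q$. Put $L^{\beta}(t) = \prod_{\alpha \in \mathbb{F}_q \setminus \{\beta\}} \frac{t-\alpha}{\beta-\alpha}$ for $\beta \in \mathbb{F}_q$, and $$f_i = \sum_{b \in S} \Big[ \sum_{j=1}^n \mathcal{H}(b)_{ij}\,(x_j - x_j^q) \Big] \prod_{j=1}^n L^{b_j^p}(x_j^p), \qquad 1 \le i \le n-k .$$ Let $X = V(f_1,\dots,f_{n-k}) \subseteq \overline{\mathbb{F}_q}^n$. Then $\mathbb{F}_q^n \subseteq X$, and for every $a \in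 S$, every irreducible component $Y$ of $X$ through $a$ is defined over $\mathbb{F}_q$, has dimension $k$, is smooth at $a$, and satisfies $T_a(Y,\mathbb{F}_q) = \mathcal{C}(a)$. -/

import Mathlib

open MvPolynomial

section AffineVarieties

variable {σ K : Type*} [Field K]

/-- `X` is an affine variety in the affine space `K ^ σ`: the common zero set of a set of polynomials
(equivalently of an ideal, equivalently of finitely many polynomials). -/
def IsAffineVariety (X : Set (σ → K)) : Prop :=
  ∃ I : Ideal (MvPolynomial σ K), X = zeroLocus K I

/-- `X` is an irreducible affine variety: a non-empty Zariski closed set which is not a union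
of two proper Zariski closed subsets. -/
def IsIrreducibleVariety (X : Set (σ → K)) : Prop :=
  IsAffineVariety X ∧ X.Nonempty ∧
    ∀ Z₁ Z₂ : Set (σ → K), IsAffineVariety Z₁ → IsAffineVariety Z₂ → X = Z₁ ∪ Z₂ →
      Z₁ = X ∨ Z₂ = X

/-- `Y` is an irreducible component of `X`: a maximal irreducible closed subset of `X`. -/
def IsIrreducibleComponent (X Y : Set (σ → K)) : Prop :=
  Maximal (fun Z : Set (σ → K) => IsIrreducibleVariety Z ∧ Z ⊆ X) Y

/-- `X` is defined over the subfield `F`: the absolute ideal `I(X, K)` is generated by polynomials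
with coefficients in `F`. -/
def IsDefinedOver (F : Type*) [Field F] [Algebra F K] (X : Set (σ → K)) : Prop :=
  ∃ T : Set (MvPolynomial σ F),
    vanishingIdeal K X = Ideal.span (MvPolynomial.map (algebraMap F K) '' T)

/-- The dimension of an affine variety: the Krull dimension of its coordinate ring
`K[x] / I(X, K)`. -/
noncomputable def varietyDim (X : Set (σ → K)) : WithBot ℕ∞ :=
  ringKrullDim (MvPolynomial σ K ⧸ (vanishingIdeal K X : Ideal (MvPolynomial σ K)))

/-- The inclusion `F ^ σ ⊆ K ^ σ`. -/
def rationalPoint {F : Type*} [Field F] (K : Type*) [Field K] [Algebra F K] (a : σ → F) : σ → K :=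
  fun j => algebraMap F K (a j)

/-- The Zariski tangent space `T_a(X, F)` in coordinates: the space of all `v` in `F ^ σ` which are
annihilated by the differentials at `a` of all polynomials with coefficients in `F`
that vanish on `X`. -/
noncomputable def zariskiTangentSpace {F : Type*} [Field F] [Algebra F K] [Fintype σ]
    (X : Set (σ → K)) (a : σ → F) : Submodule F (σ → F) where
  carrier := {v | ∀ f ∈ (vanishingIdeal F X : Ideal (MvPolynomial σ F)),
    ∑ j, eval a (pderiv j f) * v j = 0}
  zero_mem' := by
    intro f _
    simp
  add_mem' := by
    intro v w hv hw f hf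
    simp [mul_add, Finset.sum_add_distrib, hv f hf, hw f hf]
  smul_mem' := by
    intro c v hv f hf
    have h := hv f hf
    simp only [Pi.smul_apply, smul_eq_mul]
    calc ∑ j, eval a (pderiv j f) * (c * v j) = c * ∑ j, eval a (pderiv j f) * v j := by
          rw [Finset.mul_sum]
          exact Finset.sum_congr rfl fun j _ => by ring
      _ = 0 := by rw [h, mul_zero]

/-- `a` is a smooth point of the irreducible variety `X`: it lies on `X`, and the tangent space
`T_a(X, K)` has dimension `dim X` over `K`. -/
def IsSmoothPoint [Fintype σ] (X : Set (σ → K)) (a : σ → K) : Prop :=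
  a ∈ X ∧ ((Module.finrank K (zariskiTangentSpace X a : Submodule K (σ → K)) : ℕ) : WithBot ℕ∞) =
    varietyDim X

end AffineVarieties

section Interpolation

variable {F : Type*} [Field F] [Fintype F] {n m : ℕ}

open Classical in
/-- The Lagrange basis polynomial `L^β(t) = ∏_{α ∈ F, α ≠ β} (t - α) / (β - α)` of the finite
field `F`. -/
noncomputable def lagrangePoly (β : F) : Polynomial F :=
  ∏ α ∈ Finset.univ.erase β, Polynomial.C (β - α)⁻¹ * (Polynomial.X - Polynomial.C α)

/-- The interpolating polynomials, with `q = |F|` and `p = char F`: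
`f_i = ∑_{b ∈ S} (∑_j H(b)_{ij} (x_j - x_j ^ q)) ∏_j L^{b_j ^ p}(x_j ^ p)`. -/
noncomputable def interpolatingPoly (S : Finset (Fin n → F))
    (H : S → Matrix (Fin m) (Fin n) F) (i : Fin m) : MvPolynomial (Fin n) F :=
  ∑ b : S, (∑ j, C (H b i j) * (X j - X j ^ Fintype.card F)) *
    ∏ j, Polynomial.aeval (X j ^ ringChar F : MvPolynomial (Fin n) F)
      (lagrangePoly (b.1 j ^ ringChar F))

/-- The affine variety `V(f_1, …, f_m)` over `K` cut out by the interpolating polynomials. -/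
def interpolatingVariety (K : Type*) [Field K] [Algebra F K] (S : Finset (Fin n → F))
    (H : S → Matrix (Fin m) (Fin n) F) : Set (Fin n → K) :=
  {x | ∀ i, aeval x (interpolatingPoly S H i) = 0}

end Interpolation

/-! At a rational point every `x_j - x_j^q` vanishes and has differential `dx_j`, while the Lagrange
product attached to `b` is the indicator of `b`. So all `f_i` vanish on `F^n`, and for `a ∈ S` their
gradients at `a` are the rows of `H a`, which are linearly independent (`gradAt_interpolatingPoly`).

The rest is the Jacobian criterion. Independent gradients make the local ring at `a` modulo the
`f_i` a domain of the expected dimension (`isDomain_quotient_map_span`), so the contraction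
`localIdeal` is prime. Its zero locus is the only component through `a`. Tangent vectors are read
off from the gradients, and Frobenius stability of the ideal gives descent to `F`.

For the existence statement, the codes are extended arbitrarily to all of `F^n`; the components
through rational points then cover `F^n`, and uniqueness of the component through a point fixes
every tangent space. -/

/-! ### Regular local rings are domains. -/

/-- Induction on the number of generators: for a suitable `x` in `m`, the quotient by `x` needs one
generator fewer and loses at most one dimension, so `(x)` is prime. A minimal prime `p` inside `(x)`
not containing `x` satisfies `p = x p`, and Nakayama gives `p = 0`. -/
theorem IsLocalRing.isDomain_of_maximalIdeal_eq_span_fin {B : Type*} [CommRing B] [IsLocalRing B]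
    [IsNoetherianRing B] {n : ℕ} (t : Fin n → B)
    (ht : Ideal.span (Set.range t) = IsLocalRing.maximalIdeal B)
    (hdim : (n : WithBot ℕ∞) ≤ ringKrullDim B) : IsDomain B := by
  induction n generalizing B with
  | zero =>
    have hm : IsLocalRing.maximalIdeal B = ⊥ := by rw [← ht]; simp
    have := (IsLocalRing.isField_iff_maximalIdeal_eq (R := B)).2 hm
    exact this.isDomain
  | succ n ih =>
    set m := IsLocalRing.maximalIdeal B with hmdef
    have hht : ((n + 1 : ℕ) : ℕ∞) ≤ m.height := by
      rw [← IsLocalRing.maximalIdeal_height_eq_ringKrullDim] at hdim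
      exact_mod_cast hdim
    have hmmin : ∀ p ∈ minimalPrimes B, ¬ m ≤ p := by
      intro p hp hmp
      have hpp : p.IsPrime := hp.1.1
      have h0 := (Ideal.height_eq_zero_iff (I := p)).2 hp
      have := hht.trans (Ideal.height_mono hmp)
      rw [h0] at this
      simp at this
    have hmsq : ¬ m ≤ m ^ 2 := by
      intro h
      have hb : m = ⊥ := by
        refine Submodule.eq_bot_of_le_smul_of_le_jacobson_bot m m (IsNoetherian.noetherian m) ?_
          (IsLocalRing.maximalIdeal_le_jacobson ⊥)
        rwa [smul_eq_mul, ← pow_two]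
      obtain ⟨p, hp⟩ := Ideal.nonempty_minimalPrimes (R := B) (I := ⊥) top_ne_bot.symm
      exact hmmin p hp (by rw [hb]; exact bot_le)
    -- Prime avoidance; it tolerates the one ideal `m ^ 2` that need not be prime.
    obtain ⟨x, hxm, hxsq, hxmin⟩ : ∃ x ∈ m, x ∉ m ^ 2 ∧ ∀ p ∈ minimalPrimes B, x ∉ p := by
      by_contra! hcon
      have hfin : (insert (m ^ 2) (minimalPrimes B)).Finite :=
        (minimalPrimes.finite_of_isNoetherianRing B).insert _
      obtain ⟨p, hp, hmp⟩ := (Ideal.subset_union_prime_finite (I := m) hfin (f := id) (m ^ 2) (m ^ 2)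
        (fun p hp hne _ => by
          rcases hp with rfl | hp
          · exact absurd rfl hne
          · exact hp.1.1)).1 (by
            intro x hx
            by_cases hx2 : x ∈ m ^ 2
            · exact Set.mem_iUnion₂.2 ⟨_, Set.mem_insert _ _, hx2⟩
            · obtain ⟨p, hp, hxp⟩ := hcon x hx hx2
              exact Set.mem_iUnion₂.2 ⟨_, Set.mem_insert_of_mem _ hp, hxp⟩)
      rcases hp with rfl | hp
      · exact hmsq hmp
      · exact hmmin p hp hmp
    obtain ⟨c, hc⟩ := (Ideal.mem_span_range_iff_exists_fun).1 (ht.symm ▸ hxm)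
    have htm : ∀ i, t i ∈ m := fun i => ht ▸ Ideal.subset_span ⟨i, rfl⟩
    obtain ⟨i, hi⟩ : ∃ i, IsUnit (c i) := by
      by_contra! hcon
      apply hxsq
      rw [← hc, pow_two]
      exact Ideal.sum_mem _ fun i _ => Ideal.mul_mem_mul
        ((IsLocalRing.mem_maximalIdeal _).2 (hcon i)) (htm i)
    set I := Ideal.span {x} with hI
    have hIm : I ≤ m := (Ideal.span_singleton_le_iff_mem _).2 hxm
    have hItop : I ≠ ⊤ := fun h => Ideal.IsPrime.ne_top' (top_le_iff.1 (h ▸ hIm))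
    have : Nontrivial (B ⧸ I) := Ideal.Quotient.nontrivial_iff.2 hItop
    have hloc : IsLocalRing (B ⧸ I) :=
      IsLocalRing.of_surjective' (Ideal.Quotient.mk I) Ideal.Quotient.mk_surjective
    have hmax : IsLocalRing.maximalIdeal (B ⧸ I) = m.map (Ideal.Quotient.mk I) :=
      (IsLocalRing.map_maximalIdeal_of_surjective (Ideal.Quotient.mk I) Ideal.Quotient.mk_surjective).symm
    have hdom : IsDomain (B ⧸ I) := by
      refine ih (fun j => Ideal.Quotient.mk I (t (i.succAbove j))) ?_ ?_
      · rw [hmax, ← ht, Ideal.map_span, ← Set.range_comp]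
        apply le_antisymm
        · refine Ideal.span_mono ?_
          rintro _ ⟨j, rfl⟩
          exact ⟨i.succAbove j, rfl⟩
        · rw [Ideal.span_le]
          rintro _ ⟨j, rfl⟩
          rcases Fin.eq_self_or_eq_succAbove i j with rfl | ⟨j, rfl⟩
          -- Modulo `x`, the relation `∑ c l * t l = 0` has a unit coefficient at the omitted index,
          -- so that generator is redundant.
          · have h0 : (0 : B ⧸ I) = ∑ l, Ideal.Quotient.mk I (c l) * Ideal.Quotient.mk I (t l) := by
              rw [← (Ideal.Quotient.eq_zero_iff_mem (I := I)).2 (Ideal.mem_span_singleton_self x), ← hc]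
              simp
            rw [Fin.sum_univ_succAbove _ j] at h0
            have hu := hi.map (Ideal.Quotient.mk I)
            refine (Ideal.unit_mul_mem_iff_mem _ hu).1 ?_
            rw [Function.comp_apply, eq_neg_of_add_eq_zero_left h0.symm]
            exact neg_mem (Ideal.sum_mem _ fun l _ => Ideal.mul_mem_left _ _
              (Ideal.subset_span ⟨l, rfl⟩))
          · exact Ideal.subset_span ⟨j, rfl⟩
      · have h1 := Ideal.height_le_ringKrullDim_quotient_add_one (p := m) hxm
        have h2 : ((n + 1 : ℕ) : WithBot ℕ∞) ≤ ringKrullDim (B ⧸ I) + 1 :=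
          le_trans (by exact_mod_cast hht) h1
        push_cast at h2
        exact ENat.WithBot.add_le_add_one_right_iff.1 h2
    have hIp : I.IsPrime := (Ideal.Quotient.isDomain_iff_prime I).1 hdom
    obtain ⟨p, hp, hpI⟩ := Ideal.exists_minimalPrimes_le (bot_le : (⊥ : Ideal B) ≤ I)
    have hpp : p.IsPrime := hp.1.1
    have hpb : p = ⊥ := by
      refine Submodule.eq_bot_of_le_smul_of_le_jacobson_bot I p (IsNoetherian.noetherian p) ?_
        (hIm.trans (IsLocalRing.maximalIdeal_le_jacobson ⊥))
      intro y hy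
      obtain ⟨z, rfl⟩ := Ideal.mem_span_singleton'.1 (hpI hy)
      rw [smul_eq_mul, mul_comm z]
      exact Ideal.mul_mem_mul (Ideal.mem_span_singleton_self x)
        ((hpp.mem_or_mem hy).resolve_right (hxmin p hp))
    exact IsDomain.of_bot_isPrime B (hbp := hpb ▸ hpp)

theorem IsLocalRing.isDomain_quotient_of_maximalIdeal_eq_sup {A : Type*} [CommRing A] [IsLocalRing A]
    [IsNoetherianRing A] {J : Ideal A} {m : ℕ} (t : Fin m → A)
    (hmax : IsLocalRing.maximalIdeal A = J ⊔ Ideal.span (Set.range t))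
    (hdim : (m : WithBot ℕ∞) ≤ ringKrullDim (A ⧸ J)) : IsDomain (A ⧸ J) := by
  have hJm : J ≤ IsLocalRing.maximalIdeal A := hmax ▸ le_sup_left
  have hJtop : J ≠ ⊤ := fun h => Ideal.IsPrime.ne_top' (top_le_iff.1 (h ▸ hJm))
  have : Nontrivial (A ⧸ J) := Ideal.Quotient.nontrivial_iff.2 hJtop
  have hloc : IsLocalRing (A ⧸ J) :=
    IsLocalRing.of_surjective' (Ideal.Quotient.mk J) Ideal.Quotient.mk_surjective
  refine IsLocalRing.isDomain_of_maximalIdeal_eq_span_fin (fun i => Ideal.Quotient.mk J (t i)) ?_ hdim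
  rw [← IsLocalRing.map_maximalIdeal_of_surjective (Ideal.Quotient.mk J)
    Ideal.Quotient.mk_surjective, hmax, Ideal.map_sup, Ideal.map_quotient_self, bot_sup_eq,
    Ideal.map_span, ← Set.range_comp]
  rfl

/-! ### The Jacobian criterion at a point of affine space. -/

section LocalIdeals

variable {K : Type*} [Field K] {n : ℕ}

/-- The gradient of a polynomial at the point `a`. -/
noncomputable def gradAt (a : Fin n → K) : MvPolynomial (Fin n) K →ₗ[K] (Fin n → K) :=
  LinearMap.pi fun j => (aeval a).toLinearMap ∘ₗ (pderiv j).toLinearMap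

theorem gradAt_apply (a : Fin n → K) (f : MvPolynomial (Fin n) K) (j : Fin n) :
    gradAt a f j = eval a (pderiv j f) := rfl

theorem gradAt_mul (a : Fin n → K) (f g : MvPolynomial (Fin n) K) :
    gradAt a (f * g) = eval a f • gradAt a g + eval a g • gradAt a f := by
  ext j
  simp [gradAt_apply, Derivation.leibniz]

theorem gradAt_X_sub_C (a : Fin n → K) (j : Fin n) :
    gradAt a (X j - C (a j)) = Pi.single j 1 := by
  ext i
  simp [gradAt_apply, pderiv_X, Pi.single_apply, eq_comm, apply_ite]

theorem ker_eval_eq_span (a : Fin n → K) :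
    RingHom.ker (eval a) = Ideal.span (Set.range fun j => (X j - C (a j) : MvPolynomial (Fin n) K)) := by
  apply le_antisymm
  · intro f hf
    set I := Ideal.span (Set.range fun j => (X j - C (a j) : MvPolynomial (Fin n) K))
    have key : (Ideal.Quotient.mkₐ K I) = (Ideal.Quotient.mkₐ K I).comp
        ((Algebra.ofId K (MvPolynomial (Fin n) K)).comp (aeval a)) := by
      ext j
      simp only [AlgHom.comp_apply, aeval_X]
      refine Ideal.Quotient.eq.2 (Ideal.subset_span ⟨j, rfl⟩)
    have h := DFunLike.congr_fun key f
    have h0 : aeval a f = 0 := hf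
    simp only [AlgHom.comp_apply, h0, map_zero] at h
    exact Ideal.Quotient.eq_zero_iff_mem.1 h
  · rw [Ideal.span_le]
    rintro _ ⟨j, rfl⟩
    simp [RingHom.mem_ker]

/-- If `f = ∑ u j * (X j - a j)`, the gradient of `f` at `a` is the vector of values `u j (a)`. -/
theorem mem_ker_eval_sq_of_gradAt_eq_zero {a : Fin n → K} {f : MvPolynomial (Fin n) K}
    (hf : eval a f = 0) (hg : gradAt a f = 0) : f ∈ RingHom.ker (eval a) ^ 2 := by
  have hmem : f ∈ RingHom.ker (eval a) := hf
  rw [ker_eval_eq_span, Ideal.mem_span_range_iff_exists_fun] at hmem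
  obtain ⟨u, rfl⟩ := hmem
  have hu : ∀ j, eval a (u j) = 0 := by
    intro j
    have := congrFun hg j
    simpa [gradAt_mul, gradAt_X_sub_C, Finset.sum_apply, Pi.single_apply] using this
  rw [pow_two]
  refine Ideal.sum_mem _ fun j _ => Ideal.mul_mem_mul (hu j) ?_
  simp [RingHom.mem_ker]

instance isPrime_ker_eval (a : Fin n → K) : (RingHom.ker (eval a)).IsPrime :=
  RingHom.ker_isPrime _

/-- The kernels of the substitutions `φ i`, which specialize the first `i` variables to the
coordinates of `a`, form a strict chain of primes. -/
theorem le_height_ker_eval (a : Fin n → K) : (n : ℕ∞) ≤ (RingHom.ker (eval a)).height := by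
  let φ : ℕ → (MvPolynomial (Fin n) K →ₐ[K] MvPolynomial (Fin n) K) := fun i =>
    aeval fun j => if j.1 < i then C (a j) else X j
  have hcomp : ∀ i, (φ (i + 1)).comp (φ i) = φ (i + 1) := by
    intro i
    ext j
    by_cases h : j.1 < i
    · simp [φ, h, h.le]
    · simp [φ, h]
  have hprime : ∀ i, (RingHom.ker (φ i)).IsPrime := fun i => RingHom.ker_isPrime _
  have hle : ∀ i : ℕ, i ≤ n → (i : ℕ∞) ≤ (RingHom.ker (φ i)).height := by
    intro i
    induction i with
    | zero => simp
    | succ i ih =>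
      intro hi
      have hlt : RingHom.ker (φ i) < RingHom.ker (φ (i + 1)) := by
        refine lt_of_le_of_ne (fun f hf => ?_) fun heq => ?_
        · rw [RingHom.mem_ker] at hf ⊢
          rw [← hcomp, AlgHom.comp_apply, hf, map_zero]
        · have h1 : (X ⟨i, hi⟩ - C (a ⟨i, hi⟩) : MvPolynomial (Fin n) K) ∈ RingHom.ker (φ (i + 1)) := by
            simp [RingHom.mem_ker, φ]
          rw [← heq, RingHom.mem_ker] at h1
          -- `φ i` fixes `X i - a i`, whose derivative is `1`, not `0`.
          have h2 := congrArg (pderiv ⟨i, hi⟩) h1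
          simp [φ] at h2
      have := Ideal.height_add_one_le_of_lt_of_isPrime hlt
      push_cast
      exact le_trans (by gcongr; exact ih (by omega)) this
  refine (hle n le_rfl).trans (Ideal.height_mono fun f hf => ?_)
  have hφ : φ n = (Algebra.ofId K (MvPolynomial (Fin n) K)).comp (aeval a) := by
    ext j
    simp [φ, Algebra.ofId_apply]
  rw [RingHom.mem_ker, hφ, AlgHom.comp_apply, Algebra.ofId_apply, algebraMap_eq] at hf
  exact (C_injective _ _) (by rw [map_zero]; exact hf)

/-- The polynomials which lie in the ideal generated by the `g i` locally at the point `a`. -/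
noncomputable def localIdeal {ι : Type*} (a : Fin n → K) (g : ι → MvPolynomial (Fin n) K) :
    Ideal (MvPolynomial (Fin n) K) :=
  ((Ideal.span (Set.range g)).map (algebraMap _ (Localization.AtPrime (RingHom.ker (eval a))))).comap
    (algebraMap _ _)

theorem mem_localIdeal {ι : Type*} {a : Fin n → K} {g : ι → MvPolynomial (Fin n) K}
    {h : MvPolynomial (Fin n) K} :
    h ∈ localIdeal a g ↔ ∃ s, eval a s ≠ 0 ∧ s * h ∈ Ideal.span (Set.range g) := by
  rw [localIdeal, Ideal.mem_comap,
    IsLocalization.algebraMap_mem_map_algebraMap_iff (RingHom.ker (eval a)).primeCompl]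
  rfl

theorem subset_localIdeal {ι : Type*} (a : Fin n → K) (g : ι → MvPolynomial (Fin n) K) (i : ι) :
    g i ∈ localIdeal a g :=
  mem_localIdeal.2 ⟨1, by simp, by rw [one_mul]; exact Ideal.subset_span ⟨i, rfl⟩⟩

theorem gradAt_mem_span_of_mem_span {ι : Type*} {a : Fin n → K} {g : ι → MvPolynomial (Fin n) K}
    (hg : ∀ i, eval a (g i) = 0) {h : MvPolynomial (Fin n) K} (hh : h ∈ Ideal.span (Set.range g)) :
    eval a h = 0 ∧ gradAt a h ∈ Submodule.span K (Set.range fun i => gradAt a (g i)) := by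
  induction hh using Submodule.span_induction with
  | mem x hx =>
    obtain ⟨i, rfl⟩ := hx
    exact ⟨hg i, Submodule.subset_span ⟨i, rfl⟩⟩
  | zero => simp
  | add x y _ _ hx hy =>
    exact ⟨by simp [hx.1, hy.1], by rw [map_add]; exact add_mem hx.2 hy.2⟩
  | smul c x _ hx =>
    refine ⟨by simp [hx.1], ?_⟩
    rw [smul_eq_mul, gradAt_mul, hx.1, zero_smul, add_zero]
    exact Submodule.smul_mem _ _ hx.2

/-- A denominator `s` only rescales: once `h` vanishes at `a`, the gradient of `s * h` there is
`s(a)` times that of `h`. -/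
theorem gradAt_mem_span_of_mem_localIdeal {ι : Type*} {a : Fin n → K}
    {g : ι → MvPolynomial (Fin n) K} (hg : ∀ i, eval a (g i) = 0) {h : MvPolynomial (Fin n) K}
    (hh : h ∈ localIdeal a g) :
    eval a h = 0 ∧ gradAt a h ∈ Submodule.span K (Set.range fun i => gradAt a (g i)) := by
  obtain ⟨s, hs, hsh⟩ := mem_localIdeal.1 hh
  obtain ⟨h0, h1⟩ := gradAt_mem_span_of_mem_span hg hsh
  have h0' : eval a h = 0 := by
    rw [map_mul] at h0
    exact (mul_eq_zero.1 h0).resolve_left hs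
  refine ⟨h0', ?_⟩
  rw [gradAt_mul, h0', zero_smul, add_zero] at h1
  exact (Submodule.smul_mem_iff _ hs).1 h1

/-- Nakayama: as the gradients span, each `f` in `M` agrees with a combination of the `h i` up to an
element of `M ^ 2`. -/
theorem map_span_eq_maximalIdeal {κ : Type*} {a : Fin n → K} {h : κ → MvPolynomial (Fin n) K}
    (h0 : ∀ i, eval a (h i) = 0)
    (hspan : Submodule.span K (Set.range fun i => gradAt a (h i)) = ⊤) :
    (Ideal.span (Set.range h)).map
      (algebraMap _ (Localization.AtPrime (RingHom.ker (eval a)))) =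
        IsLocalRing.maximalIdeal _ := by
  set M := RingHom.ker (eval a)
  have hle : Ideal.span (Set.range h) ≤ M := by
    rw [Ideal.span_le]
    rintro _ ⟨i, rfl⟩
    exact h0 i
  rw [← IsLocalization.AtPrime.map_eq_maximalIdeal M]
  refine le_antisymm (Ideal.map_mono hle) ?_
  refine Submodule.le_of_le_smul_of_le_jacobson_bot (I := M.map (algebraMap _ _))
    (IsNoetherian.noetherian _) ?_ ?_
  · rw [IsLocalization.AtPrime.map_eq_maximalIdeal M (Localization.AtPrime M)]
    exact IsLocalRing.maximalIdeal_le_jacobson ⊥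
  · rw [smul_eq_mul, ← pow_two, ← Ideal.map_pow, ← Ideal.map_sup]
    refine Ideal.map_mono fun f hf => ?_
    have hmem : gradAt a f ∈ Submodule.span K (Set.range fun i => gradAt a (h i)) := by
      rw [hspan]; trivial
    obtain ⟨c, hc⟩ := (Finsupp.mem_span_range_iff_exists_finsupp).1 hmem
    set u := c.sum fun i x => x • h i
    have hu : u ∈ Ideal.span (Set.range h) :=
      Ideal.sum_mem _ fun i _ => by
        simp only [smul_eq_C_mul]
        exact Ideal.mul_mem_left _ _ (Ideal.subset_span ⟨i, rfl⟩)
    have hgu : gradAt a (f - u) = 0 := by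
      rw [map_sub, ← hc, map_finsuppSum]
      simp
    have h2 : f - u ∈ M ^ 2 := mem_ker_eval_sq_of_gradAt_eq_zero (sub_mem hf (hle hu)) hgu
    exact Submodule.mem_sup.2 ⟨u, hu, f - u, h2, by ring⟩

theorem exists_complement_of_linearIndependent {r : ℕ} {v : Fin r → Fin n → K}
    (hv : LinearIndependent K v) : ∃ (m : ℕ) (w : Fin m → Fin n → K),
      r + m = n ∧ Submodule.span K (Set.range (Sum.elim v w)) = ⊤ := by
  classical
  let b := Module.Basis.sumExtend hv
  have : Finite (Fin r ⊕ Module.Basis.sumExtendIndex hv) := Module.Finite.finite_basis b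
  have : Finite (Module.Basis.sumExtendIndex hv) := Finite.of_injective Sum.inr
    (Sum.inr_injective (α := Fin r))
  have : Fintype (Module.Basis.sumExtendIndex hv) := Fintype.ofFinite _
  let e := Fintype.equivFin (Module.Basis.sumExtendIndex hv)
  refine ⟨_, fun i => b (Sum.inr (e.symm i)), ?_, ?_⟩
  · have := Module.finrank_eq_card_basis b
    simpa using this.symm
  · rw [← b.span_eq]
    congr 1
    have hb : Sum.elim v (fun i => b (Sum.inr (e.symm i))) = b ∘ Sum.map id e.symm := by
      funext i
      rcases i with i | i
      · simp [b, Module.Basis.sumExtend]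
        rfl
      · rfl
    rw [hb]
    exact ((Equiv.refl (Fin r)).sumCongr e.symm).surjective.range_comp b

theorem exists_eval_eq_zero_gradAt_eq (a w : Fin n → K) :
    ∃ l : MvPolynomial (Fin n) K, eval a l = 0 ∧ gradAt a l = w := by
  refine ⟨∑ j, w j • (X j - C (a j)), by simp, ?_⟩
  simp only [map_sum, map_smul, gradAt_X_sub_C]
  ext j
  simp [Finset.sum_apply, Pi.single_apply]

/-- Completing the gradients to a spanning family by `m = n - r` affine-linear forms through `a`
yields generators of the maximal ideal. Modulo the `g i` only these `m` remain, and by Krull's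
height theorem the dimension is at least `m`. -/
theorem isDomain_quotient_map_span {r : ℕ} {a : Fin n → K} {g : Fin r → MvPolynomial (Fin n) K}
    (h0 : ∀ i, eval a (g i) = 0) (hli : LinearIndependent K fun i => gradAt a (g i)) :
    IsDomain (Localization.AtPrime (RingHom.ker (eval a)) ⧸
      (Ideal.span (Set.range g)).map (algebraMap _ (Localization.AtPrime (RingHom.ker (eval a))))) ∧
    (n : WithBot ℕ∞) ≤ ringKrullDim (Localization.AtPrime (RingHom.ker (eval a)) ⧸
      (Ideal.span (Set.range g)).map (algebraMap _ (Localization.AtPrime (RingHom.ker (eval a))))) +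
        (r : ℕ) := by
  set M := RingHom.ker (eval a)
  let A := Localization.AtPrime M
  set J := (Ideal.span (Set.range g)).map (algebraMap _ A) with hJ
  obtain ⟨m, w, hrm, hw⟩ := exists_complement_of_linearIndependent hli
  choose l hl0 hlw using exists_eval_eq_zero_gradAt_eq a
  have hmaxA : (Ideal.span (Set.range (Sum.elim g (fun i => l (w i))))).map (algebraMap _ A) =
      IsLocalRing.maximalIdeal A := by
    refine map_span_eq_maximalIdeal ?_ ?_
    · rintro (i | i)
      · exact h0 i
      · exact hl0 _
    · rw [← hw]
      congr 2
      funext i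
      rcases i with i | i
      · rfl
      · exact hlw _
  have hJm : J ≤ IsLocalRing.maximalIdeal A := by
    rw [← hmaxA]
    refine Ideal.map_mono (Ideal.span_mono ?_)
    rintro _ ⟨i, rfl⟩
    exact ⟨Sum.inl i, rfl⟩
  have hdim : (n : WithBot ℕ∞) ≤ ringKrullDim (A ⧸ J) + (r : ℕ) := by
    have h1 : (n : ℕ∞) ≤ (IsLocalRing.maximalIdeal A).height := by
      have h2 := le_height_ker_eval a
      have h3 := IsLocalization.AtPrime.ringKrullDim_eq_height M A
      rw [← IsLocalRing.maximalIdeal_height_eq_ringKrullDim] at h3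
      have h4 : (IsLocalRing.maximalIdeal A).height = M.height := by exact_mod_cast h3
      rw [h4]
      exact h2
    have hs : J = Ideal.span (Set.range fun i => algebraMap _ A (g i)) := by
      rw [hJ, Ideal.map_span, ← Set.range_comp]
      rfl
    have h2 := Ideal.height_le_ringKrullDim_quotient_add_encard (p := IsLocalRing.maximalIdeal A)
      (Set.range fun i => algebraMap _ A (g i)) (Ideal.span_le.1 (hs ▸ hJm))
    rw [← hs] at h2
    have h3 : (Set.range fun i => algebraMap _ A (g i)).encard ≤ (r : ℕ) := by
      rw [← Set.image_univ]
      exact (Set.encard_image_le _ _).trans (by simp)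
    calc (n : WithBot ℕ∞) ≤ ((IsLocalRing.maximalIdeal A).height : WithBot ℕ∞) := by
          exact_mod_cast h1
      _ ≤ _ := h2
      _ ≤ _ := by gcongr; exact_mod_cast h3
  refine ⟨?_, hdim⟩
  refine IsLocalRing.isDomain_quotient_of_maximalIdeal_eq_sup
    (fun i : Fin m => algebraMap _ A (l (w i))) ?_ ?_
  · rw [← hmaxA, Set.Sum.elim_range, Ideal.span_union, Ideal.map_sup, ← hJ]
    congr 1
    rw [Ideal.map_span, ← Set.range_comp]
    rfl
  · have hcast : (n : WithBot ℕ∞) = (m : ℕ) + (r : ℕ) := by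
      rw [← Nat.cast_add, add_comm, hrm]
    exact ENat.WithBot.add_le_add_natCast_right_iff.1 (hcast ▸ hdim)

theorem localIdeal_isPrime {r : ℕ} {a : Fin n → K} {g : Fin r → MvPolynomial (Fin n) K}
    (h0 : ∀ i, eval a (g i) = 0) (hli : LinearIndependent K fun i => gradAt a (g i)) :
    (localIdeal a g).IsPrime := by
  have := (isDomain_quotient_map_span h0 hli).1
  have := (Ideal.Quotient.isDomain_iff_prime _).1 this
  exact Ideal.comap_isPrime _ _

/-- Adding one equation strictly enlarges the prime, since its gradient lies outside the span of the
previous ones. -/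
theorem le_height_localIdeal {r : ℕ} {a : Fin n → K} {g : Fin r → MvPolynomial (Fin n) K}
    (h0 : ∀ i, eval a (g i) = 0) (hli : LinearIndependent K fun i => gradAt a (g i)) :
    (r : ℕ∞) ≤ (localIdeal a g).height := by
  induction r with
  | zero => simp
  | succ r ih =>
    have h0' : ∀ i : Fin r, eval a (g i.castSucc) = 0 := fun i => h0 _
    have hli' : LinearIndependent K fun i : Fin r => gradAt a (g i.castSucc) :=
      hli.comp Fin.castSucc (Fin.castSucc_injective r)
    have := localIdeal_isPrime h0 hli
    have := localIdeal_isPrime h0' hli'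
    have hlt : localIdeal a (fun i : Fin r => g i.castSucc) < localIdeal a g := by
      refine lt_of_le_of_ne ?_ fun heq => ?_
      · refine Ideal.comap_mono (Ideal.map_mono (Ideal.span_mono ?_))
        rintro _ ⟨i, rfl⟩
        exact ⟨_, rfl⟩
      · have hmem := subset_localIdeal a g (Fin.last r)
        rw [← heq] at hmem
        have h1 := (gradAt_mem_span_of_mem_localIdeal h0' hmem).2
        refine hli.notMem_span_image (s := Set.range Fin.castSucc) (x := Fin.last r) ?_ ?_
        · rintro ⟨i, hi⟩
          exact (Fin.castSucc_lt_last i).ne hi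
        · rw [← Set.range_comp]
          exact h1
    have := Ideal.height_add_one_le_of_lt_of_isPrime hlt
    push_cast
    exact le_trans (by gcongr; exact ih h0' hli') this

theorem ringKrullDim_quotient_add_height_le {R : Type*} [CommRing R] (p : Ideal R) [hp : p.IsPrime] :
    ringKrullDim (R ⧸ p) + p.height ≤ ringKrullDim R := by
  let P : PrimeSpectrum R := ⟨p, hp⟩
  have hne : Nonempty (PrimeSpectrum R) := ⟨P⟩
  have h1 : ringKrullDim (R ⧸ p) = Order.coheight P := by
    rw [ringKrullDim_quotient, Order.coheight_eq_krullDim_Ici]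
    rfl
  have h2 : p.height = Order.height P := PrimeSpectrum.height_eq_orderHeight P
  rw [h1, h2, ringKrullDim, Order.krullDim_eq_iSup_height_add_coheight_of_nonempty]
  rw [← WithBot.coe_add, add_comm]
  exact WithBot.coe_le_coe.2 (le_iSup (fun a => Order.height a + Order.coheight a) P)

/-- The height bound gives `≤`. For `≥`, chains of primes in the quotient of the local ring contract
to strict chains above `localIdeal`. -/
theorem ringKrullDim_quotient_localIdeal {r : ℕ} {a : Fin n → K}
    {g : Fin r → MvPolynomial (Fin n) K}
    (h0 : ∀ i, eval a (g i) = 0) (hli : LinearIndependent K fun i => gradAt a (g i)) :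
    ringKrullDim (MvPolynomial (Fin n) K ⧸ localIdeal a g) + (r : ℕ) = (n : ℕ) := by
  have hp := localIdeal_isPrime h0 hli
  apply le_antisymm
  · calc ringKrullDim (MvPolynomial (Fin n) K ⧸ localIdeal a g) + (r : ℕ)
        ≤ ringKrullDim (MvPolynomial (Fin n) K ⧸ localIdeal a g) + (localIdeal a g).height := by
          gcongr
          exact_mod_cast le_height_localIdeal h0 hli
      _ ≤ ringKrullDim (MvPolynomial (Fin n) K) := ringKrullDim_quotient_add_height_le _
      _ = (n : ℕ) := by
          rw [MvPolynomial.ringKrullDim_of_isNoetherianRing, ringKrullDim_eq_zero_of_field]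
          simp
  · refine (isDomain_quotient_map_span h0 hli).2.trans ?_
    gcongr
    rw [ringKrullDim_quotient, ringKrullDim_quotient]
    let A := Localization.AtPrime (RingHom.ker (eval a))
    let J := (Ideal.span (Set.range g)).map (algebraMap _ A)
    let c : PrimeSpectrum A → PrimeSpectrum (MvPolynomial (Fin n) K) :=
      PrimeSpectrum.comap (algebraMap _ A)
    have hc : StrictMono c := by
      refine Monotone.strictMono_of_injective (fun P Q h => Ideal.comap_mono h) ?_
      exact PrimeSpectrum.localization_comap_injective A (RingHom.ker (eval a)).primeCompl
    refine Order.krullDim_le_of_strictMono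
      (fun P : PrimeSpectrum.zeroLocus (J : Set A) => (⟨c P.1, ?_⟩ :
        PrimeSpectrum.zeroLocus (localIdeal a g : Set (MvPolynomial (Fin n) K)))) ?_
    · exact fun f hf => P.2 hf
    · exact fun P Q h => hc h

end LocalIdeals

/-! ### Irreducible varieties and prime ideals. -/

section Irreducible

variable {σ K : Type*} [Field K]

theorem IsAffineVariety.zeroLocus_vanishingIdeal {X : Set (σ → K)} (hX : IsAffineVariety X) :
    zeroLocus K (vanishingIdeal K X) = X := by
  obtain ⟨I, rfl⟩ := hX
  exact le_antisymm (zeroLocus_anti_mono (le_vanishingIdeal_zeroLocus I))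
    (zeroLocus_vanishingIdeal_le _)

theorem isIrreducibleVariety_zeroLocus [Finite σ] [IsAlgClosed K] (P : Ideal (MvPolynomial σ K))
    [hP : P.IsPrime] : IsIrreducibleVariety (zeroLocus K P) := by
  refine ⟨⟨P, rfl⟩, ?_, ?_⟩
  · rw [Set.nonempty_iff_ne_empty]
    intro h
    have h1 := IsPrime.vanishingIdeal_zeroLocus (K := K) P
    rw [h, vanishingIdeal_empty] at h1
    exact hP.ne_top h1.symm
  · rintro _ _ ⟨I, rfl⟩ ⟨J, rfl⟩ hU
    have hle : I ⊓ J ≤ P := by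
      rw [← IsPrime.vanishingIdeal_zeroLocus (K := K) P]
      intro f hf x hx
      rw [hU] at hx
      rcases hx with hx | hx
      · exact hx f hf.1
      · exact hx f hf.2
    rcases hP.inf_le.1 hle with h | h
    · exact Or.inl (le_antisymm (hU ▸ Set.subset_union_left) (zeroLocus_anti_mono h))
    · exact Or.inr (le_antisymm (hU ▸ Set.subset_union_right) (zeroLocus_anti_mono h))

theorem IsIrreducibleVariety.isPrime_vanishingIdeal {Y : Set (σ → K)}
    (hY : IsIrreducibleVariety Y) : (vanishingIdeal K Y).IsPrime := by
  obtain ⟨hY1, ⟨y, hy⟩, hY3⟩ := hY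
  refine ⟨fun h => ?_, fun {f g} hfg => ?_⟩
  · have h1 : (1 : MvPolynomial σ K) ∈ vanishingIdeal K Y := h ▸ Submodule.mem_top
    simpa using h1 y hy
  · have haff : ∀ h : MvPolynomial σ K, IsAffineVariety (Y ∩ {x | aeval x h = 0}) := by
      intro h
      refine ⟨vanishingIdeal K Y ⊔ Ideal.span {h}, ?_⟩
      ext x
      constructor
      · rintro ⟨hx, hxh⟩ u' hu'
        obtain ⟨u, hu, v, hv, rfl⟩ := Submodule.mem_sup.1 hu'
        obtain ⟨w, rfl⟩ := Ideal.mem_span_singleton'.1 hv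
        have hxh' : aeval x h = 0 := hxh
        rw [map_add, map_mul, mem_vanishingIdeal_iff.1 hu x hx, hxh', mul_zero, add_zero]
      · intro hx
        refine ⟨?_, hx h (le_sup_right (a := vanishingIdeal K Y)
          (Ideal.mem_span_singleton_self h))⟩
        rw [← hY1.zeroLocus_vanishingIdeal]
        exact fun u hu => hx u (le_sup_left (a := vanishingIdeal K Y) hu)
    rcases hY3 _ _ (haff f) (haff g) (by
      rw [← Set.inter_union_distrib_left]
      refine (Set.inter_eq_left.2 fun x hx => ?_).symm
      have := hfg x hx
      rw [map_mul] at this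
      exact mul_eq_zero.1 this) with h | h
    · exact Or.inl fun x hx => (h.symm ▸ hx : x ∈ Y ∩ _).2
    · exact Or.inr fun x hx => (h.symm ▸ hx : x ∈ Y ∩ _).2

end Irreducible

/-! ### The unique component through a regular point. -/

section Component

variable {K : Type*} [Field K] {n r : ℕ}

theorem zeroLocus_localIdeal_subset {ι : Type*} (a : Fin n → K)
    (g : ι → MvPolynomial (Fin n) K) :
    zeroLocus K (localIdeal a g) ⊆ {x | ∀ i, eval x (g i) = 0} :=
  fun _ hx i => hx (g i) (subset_localIdeal a g i)

theorem mem_zeroLocus_localIdeal {ι : Type*} {a : Fin n → K} {g : ι → MvPolynomial (Fin n) K}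
    (h0 : ∀ i, eval a (g i) = 0) : a ∈ zeroLocus K (localIdeal a g) :=
  fun _ hf => (gradAt_mem_span_of_mem_localIdeal h0 hf).1

/-- If `s * h` vanishes on `Y` and `s(a) ≠ 0`, primality of the ideal of `Y` forces `h` to vanish on
`Y`. -/
theorem subset_zeroLocus_localIdeal {ι : Type*} {a : Fin n → K} {g : ι → MvPolynomial (Fin n) K}
    {Y : Set (Fin n → K)} (hY : IsIrreducibleVariety Y) (haY : a ∈ Y)
    (hYg : Y ⊆ {x | ∀ i, eval x (g i) = 0}) : Y ⊆ zeroLocus K (localIdeal a g) := by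
  have hq := hY.isPrime_vanishingIdeal
  intro x hx h hh
  obtain ⟨s, hs, hsh⟩ := mem_localIdeal.1 hh
  have hle : Ideal.span (Set.range g) ≤ vanishingIdeal K Y := by
    rw [Ideal.span_le]
    rintro _ ⟨i, rfl⟩ y hy
    exact hYg hy i
  exact ((hq.mem_or_mem (hle hsh)).resolve_left fun h => hs (h a haY)) x hx

theorem IsIrreducibleComponent.eq_zeroLocus_localIdeal [IsAlgClosed K] {a : Fin n → K}
    {g : Fin r → MvPolynomial (Fin n) K}
    (h0 : ∀ i, eval a (g i) = 0) (hli : LinearIndependent K fun i => gradAt a (g i))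
    {Y : Set (Fin n → K)} (hY : IsIrreducibleComponent {x | ∀ i, eval x (g i) = 0} Y)
    (haY : a ∈ Y) : Y = zeroLocus K (localIdeal a g) := by
  have := localIdeal_isPrime h0 hli
  exact hY.eq_of_le ⟨isIrreducibleVariety_zeroLocus _, zeroLocus_localIdeal_subset a g⟩
    (subset_zeroLocus_localIdeal hY.1.1 haY hY.1.2)

end Component

/-! ### Descent of ideals to a finite field. -/

section Descent

variable {σ F K : Type*} [Field F] [Fintype F] [Field K] [Algebra F K]

theorem FiniteField.mem_range_algebraMap_of_pow_card_eq {x : K} (hx : x ^ Fintype.card F = x) :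
    x ∈ Set.range (algebraMap F K) := by
  classical
  have hne : (Polynomial.X ^ Fintype.card F - Polynomial.X : Polynomial K) ≠ 0 :=
    FiniteField.X_pow_card_sub_X_ne_zero K Fintype.one_lt_card
  have hroot : x ∈ (Polynomial.X ^ Fintype.card F - Polynomial.X : Polynomial K).roots := by
    rw [Polynomial.mem_roots hne]
    simp [hx]
  have hmap : (Polynomial.X ^ Fintype.card F - Polynomial.X : Polynomial K) =
      (Polynomial.X ^ Fintype.card F - Polynomial.X : Polynomial F).map (algebraMap F K) := by simp
  have hsplit : (Polynomial.X ^ Fintype.card F - Polynomial.X : Polynomial F).Splits := by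
    rw [Polynomial.splits_iff_card_roots, FiniteField.roots_X_pow_card_sub_X,
      FiniteField.X_pow_card_sub_X_natDegree_eq F Fintype.one_lt_card]
    rfl
  rw [hmap, hsplit.roots_map, FiniteField.roots_X_pow_card_sub_X] at hroot
  obtain ⟨y, -, rfl⟩ := Multiset.mem_map.1 hroot
  exact ⟨y, rfl⟩

/-- Galois descent for ideals along an algebraic extension of a finite field, where the Galois
group is topologically generated by the Frobenius. -/
theorem MvPolynomial.eq_span_comap_of_frobenius_stable {J : Ideal (MvPolynomial σ K)}
    (hJ : ∀ f ∈ J, MvPolynomial.map (FiniteField.frobeniusAlgHom F K : K →+* K) f ∈ J) :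
    J = Ideal.span (MvPolynomial.map (algebraMap F K) ''
      (J.comap (MvPolynomial.map (algebraMap F K)) : Set (MvPolynomial σ F))) := by
  classical
  set φ : K →+* K := (FiniteField.frobeniusAlgHom F K : K →+* K)
  set D := Ideal.span (MvPolynomial.map (algebraMap F K) ''
      (J.comap (MvPolynomial.map (algebraMap F K)) : Set (MvPolynomial σ F)))
  apply le_antisymm
  swap
  · rw [Ideal.span_le]
    rintro _ ⟨f, hf, rfl⟩
    exact hf
  have hfix : ∀ f ∈ J, MvPolynomial.map φ f = f → f ∈ D := by
    intro f hf hφ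
    have hr : f ∈ Set.range (MvPolynomial.map (algebraMap F K) : MvPolynomial σ F →+* _) := by
      rw [MvPolynomial.mem_range_map_iff_coeffs_subset]
      intro x hx
      obtain ⟨m, -, rfl⟩ := MvPolynomial.mem_coeffs_iff.1 hx
      apply FiniteField.mem_range_algebraMap_of_pow_card_eq
      conv_rhs => rw [← hφ]
      rw [coeff_map]
      rfl
    obtain ⟨u, rfl⟩ := hr
    exact Ideal.subset_span ⟨u, hf, rfl⟩
  have hsub : ∀ (f h : MvPolynomial σ K) (m : σ →₀ ℕ), m ∈ f.support → h.support ⊆ f.support →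
      coeff m h = coeff m f → (f - h).support ⊂ f.support := by
    intro f h m hm hh hc
    refine Finset.ssubset_iff_subset_ne.2 ⟨?_, fun heq => ?_⟩
    · exact (MvPolynomial.support_sub σ f h).trans (Finset.union_subset le_rfl hh)
    · rw [← heq] at hm
      simp [hc] at hm
  -- every nonzero element of `J` dominates, on supports, a nonzero fixed element of `J`
  have hmin : ∀ (N : ℕ) (f : MvPolynomial σ K), f.support.card = N → f ∈ J → f ≠ 0 →
      ∃ h ∈ D, h ≠ 0 ∧ h.support ⊆ f.support := by
    intro N
    induction N using Nat.strong_induction_on with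
    | _ N ih =>
      intro f hN hf hne
      obtain ⟨m, hm⟩ := MvPolynomial.support_nonempty.2 hne
      have hcm : coeff m f ≠ 0 := MvPolynomial.mem_support_iff.1 hm
      set u := C (coeff m f)⁻¹ * f
      have hu : u ∈ J := Ideal.mul_mem_left _ _ hf
      have hus : u.support ⊆ f.support := by
        intro l hl
        simp only [MvPolynomial.mem_support_iff, u, coeff_C_mul] at hl ⊢
        exact right_ne_zero_of_mul hl
      have hum : coeff m u = 1 := by simp [u, coeff_C_mul, hcm]
      have hum' : m ∈ u.support := by simp [hum]
      by_cases hφ : MvPolynomial.map φ u = u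
      · refine ⟨u, hfix u hu hφ, ?_, hus⟩
        rintro h0
        simp [h0] at hum
      -- The coefficient of `u` at `m` was normalized to `1`, which Frobenius fixes, so `u - φ u`
      -- loses the monomial `m`.
      · have hss := hsub u (MvPolynomial.map φ u) m hum' (MvPolynomial.support_map_subset _ _)
          (by simp [coeff_map, hum])
        obtain ⟨h, hD, h0, hs⟩ := ih _ (hN ▸ (Finset.card_lt_card hss).trans_le
          (Finset.card_le_card hus)) (u - MvPolynomial.map φ u) rfl (sub_mem hu (hJ u hu))
          (sub_ne_zero.2 (Ne.symm hφ))
        exact ⟨h, hD, h0, hs.trans (hss.subset.trans hus)⟩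
  have main : ∀ (N : ℕ) (f : MvPolynomial σ K), f.support.card = N → f ∈ J → f ∈ D := by
    intro N
    induction N using Nat.strong_induction_on with
    | _ N ih =>
      intro f hN hf
      by_cases hne : f = 0
      · rw [hne]; exact zero_mem _
      obtain ⟨h, hD, h0, hs⟩ := hmin _ f rfl hf hne
      have hDJ : D ≤ J := by
        rw [Ideal.span_le]
        rintro _ ⟨f, hf, rfl⟩
        exact hf
      obtain ⟨m, hm⟩ := MvPolynomial.support_nonempty.2 h0
      have hcm : coeff m h ≠ 0 := MvPolynomial.mem_support_iff.1 hm
      -- This multiple of `h` cancels the monomial `m` of `f` without creating new monomials.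
      set v := C (coeff m f / coeff m h) * h
      have hv : v ∈ D := Ideal.mul_mem_left _ _ hD
      have hvs : v.support ⊆ f.support := by
        intro l hl
        simp only [MvPolynomial.mem_support_iff, v, coeff_C_mul] at hl
        exact hs (MvPolynomial.mem_support_iff.2 (right_ne_zero_of_mul hl))
      have hss := hsub f v m (hs hm) hvs (by simp [v, coeff_C_mul, hcm])
      have := ih _ (hN ▸ Finset.card_lt_card hss) (f - v) rfl (sub_mem hf (hDJ hv))
      simpa using add_mem this hv
  exact fun f hf => main _ f rfl hf

end Descent

/-! ### Local varieties at rational points: field of definition, dimension, tangent space. -/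

section RationalPoints

variable {F K : Type*} [Field F] [Field K] [Algebra F K] {n r : ℕ}

theorem eval_rationalPoint_map (a : Fin n → F) (f : MvPolynomial (Fin n) F) :
    eval (rationalPoint K a) (MvPolynomial.map (algebraMap F K) f) = algebraMap F K (eval a f) := by
  rw [eval_map]
  exact (eval₂_comp (algebraMap F K) a f).symm

theorem gradAt_rationalPoint_map (a : Fin n → F) (f : MvPolynomial (Fin n) F) :
    gradAt (rationalPoint K a) (MvPolynomial.map (algebraMap F K) f) =
      rationalPoint K (gradAt a f) := by
  ext j
  rw [gradAt_apply, pderiv_map, eval_rationalPoint_map]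
  rfl

/-- Frobenius fixes the equations and the point `a`, so it carries a denominator `s` for `h` to one
for the image of `h`. -/
theorem localIdeal_frobenius_stable [Fintype F] {ι : Type*} (a : Fin n → F)
    (f : ι → MvPolynomial (Fin n) F) {h : MvPolynomial (Fin n) K}
    (hh : h ∈ localIdeal (rationalPoint K a) fun i => MvPolynomial.map (algebraMap F K) (f i)) :
    MvPolynomial.map (FiniteField.frobeniusAlgHom F K : K →+* K) h ∈
      localIdeal (rationalPoint K a) fun i => MvPolynomial.map (algebraMap F K) (f i) := by
  obtain ⟨s, hs, hsh⟩ := mem_localIdeal.1 hh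
  set φ : K →+* K := (FiniteField.frobeniusAlgHom F K : K →+* K)
  have hφF : φ.comp (algebraMap F K) = algebraMap F K :=
    (FiniteField.frobeniusAlgHom F K).comp_algebraMap
  have ha : φ ∘ rationalPoint K a = rationalPoint K a := by
    funext j
    exact DFunLike.congr_fun hφF (a j)
  refine mem_localIdeal.2 ⟨MvPolynomial.map φ s, ?_, ?_⟩
  · rw [← ha, eval_map, ← eval₂_comp]
    exact (map_ne_zero φ).2 hs
  · rw [← map_mul]
    have := Ideal.mem_map_of_mem (MvPolynomial.map φ) hsh
    rw [Ideal.map_span, ← Set.range_comp] at this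
    convert this using 4 with i
    simp [MvPolynomial.map_map, hφF]

/-- The Zariski closed set `V` of all points which satisfy the equations `f i = 0`
locally at `a`. -/
def localVariety (K : Type*) [Field K] [Algebra F K] (a : Fin n → F)
    (f : Fin r → MvPolynomial (Fin n) F) : Set (Fin n → K) :=
  zeroLocus K (localIdeal (rationalPoint K a) fun i => MvPolynomial.map (algebraMap F K) (f i))

section Regular

variable {a : Fin n → F} {f : Fin r → MvPolynomial (Fin n) F}

theorem eval_rationalPoint_map_eq_zero (h0 : ∀ i, eval a (f i) = 0) (i : Fin r) :
    eval (rationalPoint K a) (MvPolynomial.map (algebraMap F K) (f i)) = 0 := by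
  rw [eval_rationalPoint_map, h0, map_zero]

theorem linearIndependent_gradAt_map (hli : LinearIndependent F fun i => gradAt a (f i)) :
    LinearIndependent K fun i =>
      gradAt (rationalPoint K a) (MvPolynomial.map (algebraMap F K) (f i)) := by
  simp_rw [gradAt_rationalPoint_map]
  exact (linearIndependent_algebraMap_comp_iff (S := K)).2 hli

theorem mem_localVariety (h0 : ∀ i, eval a (f i) = 0) : rationalPoint K a ∈ localVariety K a f :=
  mem_zeroLocus_localIdeal (eval_rationalPoint_map_eq_zero h0)

variable [IsAlgClosed K] (h0 : ∀ i, eval a (f i) = 0)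
  (hli : LinearIndependent F fun i => gradAt a (f i))
include h0 hli

theorem isIrreducibleVariety_localVariety : IsIrreducibleVariety (localVariety K a f) := by
  have := localIdeal_isPrime (eval_rationalPoint_map_eq_zero (K := K) h0)
    (linearIndependent_gradAt_map hli)
  exact isIrreducibleVariety_zeroLocus _

theorem vanishingIdeal_localVariety : vanishingIdeal K (localVariety K a f) =
    localIdeal (rationalPoint K a) fun i => MvPolynomial.map (algebraMap F K) (f i) := by
  have := localIdeal_isPrime (eval_rationalPoint_map_eq_zero (K := K) h0)
    (linearIndependent_gradAt_map hli)
  exact IsPrime.vanishingIdeal_zeroLocus _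

theorem isDefinedOver_localVariety [Fintype F] : IsDefinedOver F (localVariety K a f) := by
  refine ⟨_, (vanishingIdeal_localVariety h0 hli).trans
    (eq_span_comap_of_frobenius_stable (F := F) fun _ hh => localIdeal_frobenius_stable a f hh)⟩

theorem varietyDim_localVariety : varietyDim (localVariety K a f) + (r : ℕ) = (n : ℕ) := by
  rw [varietyDim, vanishingIdeal_localVariety h0 hli]
  exact ringKrullDim_quotient_localIdeal (eval_rationalPoint_map_eq_zero h0)
    (linearIndependent_gradAt_map hli)

theorem mem_zariskiTangentSpace_localVariety_self {v : Fin n → K} :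
    v ∈ zariskiTangentSpace (localVariety K a f) (rationalPoint K a) ↔
      ∀ i, rationalPoint K (gradAt a (f i)) ⬝ᵥ v = 0 := by
  change (∀ h ∈ vanishingIdeal K (localVariety K a f), gradAt (rationalPoint K a) h ⬝ᵥ v = 0) ↔ _
  rw [vanishingIdeal_localVariety h0 hli]
  constructor
  · intro h i
    rw [← gradAt_rationalPoint_map]
    exact h _ (subset_localIdeal _ _ i)
  · intro h u hu
    have hmem := (gradAt_mem_span_of_mem_localIdeal (eval_rationalPoint_map_eq_zero h0) hu).2
    generalize gradAt (rationalPoint K a) u = w at hmem ⊢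
    induction hmem using Submodule.span_induction with
    | mem x hx =>
      obtain ⟨i, rfl⟩ := hx
      simp only [gradAt_rationalPoint_map]
      exact h i
    | zero => simp
    | add x y _ _ hx hy => rw [add_dotProduct, hx, hy, add_zero]
    | smul c x _ hx => rw [smul_dotProduct, hx, smul_zero]

theorem mem_zariskiTangentSpace_localVariety {v : Fin n → F} :
    v ∈ zariskiTangentSpace (localVariety K a f) a ↔ ∀ i, gradAt a (f i) ⬝ᵥ v = 0 := by
  have hcast : ∀ w : Fin n → F, rationalPoint K w ⬝ᵥ rationalPoint K v = algebraMap F K (w ⬝ᵥ v) := by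
    intro w
    simp [dotProduct, rationalPoint]
  change (∀ h ∈ vanishingIdeal F (localVariety K a f), gradAt a h ⬝ᵥ v = 0) ↔ _
  constructor
  · refine fun h i => h _ fun x hx => ?_
    have := hx _ (subset_localIdeal _ _ i)
    rwa [aeval_map_algebraMap] at this
  · intro h u hu
    have hv := (mem_zariskiTangentSpace_localVariety_self (K := K) h0 hli
      (v := rationalPoint K v)).2 fun i => by rw [hcast, h, map_zero]
    have := hv (MvPolynomial.map (algebraMap F K) u) fun x hx => by
      rw [aeval_map_algebraMap]
      exact hu x hx
    change gradAt (rationalPoint K a) _ ⬝ᵥ _ = 0 at this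
    rw [gradAt_rationalPoint_map, hcast] at this
    exact (algebraMap F K).injective (by rw [this, map_zero])

/-- Rank-nullity: the tangent space is the kernel of an `r × n` matrix of rank `r`, and the variety
has dimension `n - r`. -/
theorem isSmoothPoint_localVariety :
    IsSmoothPoint (localVariety K a f) (rationalPoint K a) := by
  refine ⟨mem_localVariety h0, ?_⟩
  have hli' : LinearIndependent K fun i => rationalPoint K (gradAt a (f i)) :=
    (linearIndependent_algebraMap_comp_iff (S := K)).2 hli
  let M : Matrix (Fin r) (Fin n) K := fun i => rationalPoint K (gradAt a (f i))
  have hker : zariskiTangentSpace (localVariety K a f) (rationalPoint K a) =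
      LinearMap.ker M.mulVecLin := by
    ext v
    rw [mem_zariskiTangentSpace_localVariety_self h0 hli, LinearMap.mem_ker]
    exact funext_iff.symm
  have hrank : M.rank = r := by
    simpa using LinearIndependent.rank_matrix (M := M) hli'
  have hsum := M.mulVecLin.finrank_range_add_finrank_ker
  rw [← Matrix.rank, hrank, ← hker, Module.finrank_fin_fun] at hsum
  have hdim := varietyDim_localVariety (K := K) h0 hli
  rw [add_comm] at hdim
  refine (ENat.WithBot.natCast_add_cancel.1 (hdim.trans ?_)).symm
  rw [← Nat.cast_add, hsum]

end Regular

end RationalPoints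

/-! ### Values and gradients of the interpolating polynomials. -/

section Interpolation

variable {F : Type*} [Field F] [Fintype F] {n m : ℕ}

theorem eval_lagrangePoly (β x : F) [Decidable (x = β)] :
    (lagrangePoly β).eval x = if x = β then 1 else 0 := by
  classical
  rw [lagrangePoly, Polynomial.eval_prod]
  split_ifs with h
  · subst h
    refine Finset.prod_eq_one fun α hα => ?_
    have : x - α ≠ 0 := sub_ne_zero.2 (Finset.ne_of_mem_erase hα).symm
    simp [this]
  · exact Finset.prod_eq_zero (i := x) (by simp [h]) (by simp)

/-- Ensures that the nodes `b_j^p` still separate the coordinates `b_j`. -/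
theorem pow_ringChar_injective : Function.Injective fun x : F => x ^ ringChar F := by
  have : Fact (ringChar F).Prime := ⟨CharP.char_is_prime F _⟩
  exact frobenius_inj F (ringChar F)

theorem eval_prod_lagrangePoly (a b : Fin n → F) [Decidable (a = b)] :
    eval a (∏ j, Polynomial.aeval (X j ^ ringChar F : MvPolynomial (Fin n) F)
      (lagrangePoly (b j ^ ringChar F))) = if a = b then 1 else 0 := by
  classical
  have hfac : ∀ j, eval a (Polynomial.aeval (X j ^ ringChar F : MvPolynomial (Fin n) F)
      (lagrangePoly (b j ^ ringChar F))) = if a j = b j then 1 else 0 := by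
    intro j
    have h1 := Polynomial.aeval_algHom_apply (aeval a : MvPolynomial (Fin n) F →ₐ[F] F)
      (X j ^ ringChar F) (lagrangePoly (b j ^ ringChar F))
    have h2 : aeval a (X j ^ ringChar F : MvPolynomial (Fin n) F) = a j ^ ringChar F := by simp
    rw [h2, Polynomial.coe_aeval_eq_eval, eval_lagrangePoly] at h1
    rw [pow_ringChar_injective.eq_iff] at h1
    exact h1.symm
  rw [map_prod, Finset.prod_congr rfl fun j _ => hfac j, Finset.prod_ite_zero]
  simp [funext_iff]

theorem eval_interpolatingPoly (S : Finset (Fin n → F)) (H : S → Matrix (Fin m) (Fin n) F)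
    (i : Fin m) (b : Fin n → F) : eval b (interpolatingPoly S H i) = 0 := by
  simp [interpolatingPoly, FiniteField.pow_card]

/-- The bracket vanishes at `a`, so by the product rule only the value of the Lagrange product
matters, not its derivative; that value kills every summand except `b = a`. -/
theorem gradAt_interpolatingPoly (S : Finset (Fin n → F)) (H : S → Matrix (Fin m) (Fin n) F)
    (i : Fin m) (a : S) : gradAt a.1 (interpolatingPoly S H i) = H a i := by
  classical
  have hX : ∀ j, gradAt a.1 (X j - X j ^ Fintype.card F : MvPolynomial (Fin n) F) =
      Pi.single j 1 := by
    intro j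
    ext l
    have hq : (Fintype.card F : MvPolynomial (Fin n) F) = 0 := by
      rw [← map_natCast (C : F →+* MvPolynomial (Fin n) F), FiniteField.cast_card_eq_zero, map_zero]
    rw [gradAt_apply, map_sub, pderiv_pow, hq, zero_mul, zero_mul, sub_zero, pderiv_X]
    rcases eq_or_ne j l with rfl | h
    · simp
    · simp [Pi.single_eq_of_ne h.symm, Pi.single_eq_of_ne h]
  have hlin : ∀ b : S, gradAt a.1
      (∑ j, C (H b i j) * (X j - X j ^ Fintype.card F) : MvPolynomial (Fin n) F) = H b i := by
    intro b
    simp only [← smul_eq_C_mul, map_sum, map_smul, hX]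
    ext l
    simp [Finset.sum_apply, Pi.single_apply]
  rw [interpolatingPoly, map_sum, Finset.sum_eq_single a]
  · rw [gradAt_mul, eval_prod_lagrangePoly, hlin]
    simp [FiniteField.pow_card]
  · intro b _ hb
    rw [gradAt_mul, eval_prod_lagrangePoly, if_neg fun h => hb (Subtype.ext h.symm)]
    simp [FiniteField.pow_card]
  · simp

theorem interpolatingVariety_eq (K : Type*) [Field K] [Algebra F K] (S : Finset (Fin n → F))
    (H : S → Matrix (Fin m) (Fin n) F) : interpolatingVariety K S H =
      {x | ∀ i, eval x (MvPolynomial.map (algebraMap F K) (interpolatingPoly S H i)) = 0} := by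
  ext x
  simp [interpolatingVariety, aeval_def, eval_map]

end Interpolation

/-! ### Parity check matrices. -/

section ParityCheck

variable {F : Type*} [Field F] {n k : ℕ}

theorem linearIndependent_of_finrank_ker (hk : k ≤ n) (H : Matrix (Fin (n - k)) (Fin n) F)
    (hH : Module.finrank F (LinearMap.ker H.mulVecLin) = k) :
    LinearIndependent F fun i => H i := by
  have hsum := H.mulVecLin.finrank_range_add_finrank_ker
  rw [hH, Module.finrank_fin_fun, ← Matrix.rank] at hsum
  have hrank : Module.finrank F (Submodule.span F (Set.range fun i => H i)) = n - k := by
    have := H.rank_eq_finrank_span_row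
    change H.rank = Module.finrank F (Submodule.span F (Set.range fun i => H i)) at this
    omega
  rw [linearIndependent_iff_card_eq_finrank_span, Set.finrank, hrank, Fintype.card_fin]

theorem exists_matrix_ker_eq (V : Submodule F (Fin n → F)) (hV : Module.finrank F V = k) :
    ∃ H : Matrix (Fin (n - k)) (Fin n) F, LinearMap.ker H.mulVecLin = V := by
  have hq : Module.finrank F ((Fin n → F) ⧸ V) = Module.finrank F (Fin (n - k) → F) := by
    have := V.finrank_quotient_add_finrank
    simp only [Module.finrank_fin_fun] at this ⊢
    omega
  let e := LinearEquiv.ofFinrankEq _ _ hq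
  refine ⟨LinearMap.toMatrix' (e.toLinearMap ∘ₗ V.mkQ), ?_⟩
  rw [← Matrix.toLin'_apply', Matrix.toLin'_toMatrix', LinearEquiv.ker_comp, Submodule.ker_mkQ]

theorem exists_submodule_finrank_eq (F : Type*) [Field F] (hk : k ≤ n) :
    ∃ V : Submodule F (Fin n → F), Module.finrank F V = k := by
  have hli := (Pi.basisFun F (Fin n)).linearIndependent.comp _ (Fin.castLE_injective hk)
  exact ⟨_, by simpa using finrank_span_eq_card hli⟩

end ParityCheck

/-! ### Components of the interpolating variety. -/

section Main

variable {F K : Type*} [Field F] [Fintype F] [Field K] [Algebra F K] [IsAlgClosed K] {n k : ℕ}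
  {S : Finset (Fin n → F)}

theorem linearIndependent_gradAt_interpolatingPoly (hk : k ≤ n)
    {H : S → Matrix (Fin (n - k)) (Fin n) F} (a : S)
    (hH : Module.finrank F (LinearMap.ker (H a).mulVecLin) = k) :
    LinearIndependent F fun i => gradAt a.1 (interpolatingPoly S H i) := by
  simp_rw [gradAt_interpolatingPoly]
  exact linearIndependent_of_finrank_ker hk _ hH

theorem localVariety_interpolatingPoly (hk : k ≤ n) {H : S → Matrix (Fin (n - k)) (Fin n) F}
    (a : S) (hH : Module.finrank F (LinearMap.ker (H a).mulVecLin) = k) :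
    IsIrreducibleVariety (localVariety K a.1 (interpolatingPoly S H)) ∧
    IsDefinedOver F (localVariety K a.1 (interpolatingPoly S H)) ∧
    varietyDim (localVariety K a.1 (interpolatingPoly S H)) = (k : ℕ) ∧
    IsSmoothPoint (localVariety K a.1 (interpolatingPoly S H)) (rationalPoint K a.1) ∧
    zariskiTangentSpace (localVariety K a.1 (interpolatingPoly S H)) a.1 =
      LinearMap.ker (H a).mulVecLin := by
  have h0 := fun i => eval_interpolatingPoly S H i a.1
  have hli := linearIndependent_gradAt_interpolatingPoly hk a hH
  refine ⟨isIrreducibleVariety_localVariety h0 hli, isDefinedOver_localVariety h0 hli, ?_,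
    isSmoothPoint_localVariety h0 hli, ?_⟩
  · have hdim := varietyDim_localVariety (K := K) h0 hli
    refine ENat.WithBot.add_natCast_cancel.1 (hdim.trans ?_)
    rw [← Nat.cast_add, Nat.add_sub_of_le hk]
  · ext v
    rw [mem_zariskiTangentSpace_localVariety h0 hli, LinearMap.mem_ker]
    simp_rw [gradAt_interpolatingPoly]
    exact funext_iff.symm

theorem eq_localVariety_of_isIrreducibleComponent (hk : k ≤ n)
    {H : S → Matrix (Fin (n - k)) (Fin n) F}
    (a : S) (hH : Module.finrank F (LinearMap.ker (H a).mulVecLin) = k) {Y : Set (Fin n → K)}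
    (hY : IsIrreducibleComponent (interpolatingVariety K S H) Y) (haY : rationalPoint K a.1 ∈ Y) :
    Y = localVariety K a.1 (interpolatingPoly S H) := by
  rw [interpolatingVariety_eq] at hY
  exact hY.eq_zeroLocus_localIdeal
    (eval_rationalPoint_map_eq_zero fun i => eval_interpolatingPoly S H i a.1)
    (linearIndependent_gradAt_map (linearIndependent_gradAt_interpolatingPoly hk a hH)) haY

theorem isIrreducibleComponent_localVariety (hk : k ≤ n)
    {H : S → Matrix (Fin (n - k)) (Fin n) F}
    (a : S) (hH : Module.finrank F (LinearMap.ker (H a).mulVecLin) = k) :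
    IsIrreducibleComponent (interpolatingVariety K S H)
      (localVariety K a.1 (interpolatingPoly S H)) := by
  rw [interpolatingVariety_eq]
  refine ⟨⟨(localVariety_interpolatingPoly hk a hH).1, zeroLocus_localIdeal_subset _ _⟩,
    fun Z hZ hle => subset_zeroLocus_localIdeal hZ.1 (hle ?_) hZ.2⟩
  exact mem_localVariety fun i => eval_interpolatingPoly S H i a.1

end Main

theorem proposition3p5 {F K : Type*} [Field F] [Fintype F] [Field K] [Algebra F K]
    [IsAlgClosure F K] (n k : ℕ) (hk : k ≤ n) (S : Finset (Fin n → F))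
    (C : S → Submodule F (Fin n → F)) (hC : ∀ a, Module.finrank F (C a) = k) :
    (∃ (s : ℕ) (Y : Fin s → Set (Fin n → K)),
      (∀ i, IsIrreducibleVariety (Y i) ∧ IsDefinedOver F (Y i) ∧ varietyDim (Y i) = (k : ℕ)) ∧
      (∀ b : Fin n → F, ∃ i, rationalPoint K b ∈ Y i) ∧
      (∀ a : S, ∃ i, IsSmoothPoint (Y i) (rationalPoint K a.1)) ∧
      (∀ (a : S) (i : Fin s), rationalPoint K a.1 ∈ Y i →
        zariskiTangentSpace (Y i) a.1 = C a)) ∧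
    (∀ H : S → Matrix (Fin (n - k)) (Fin n) F,
      (∀ a, LinearMap.ker (H a).mulVecLin = C a) →
      (∀ b : Fin n → F, rationalPoint K b ∈ interpolatingVariety K S H) ∧
      (∀ (a : S) (Y : Set (Fin n → K)), IsIrreducibleComponent (interpolatingVariety K S H) Y →
        rationalPoint K a.1 ∈ Y →
        IsDefinedOver F Y ∧ varietyDim Y = (k : ℕ) ∧ IsSmoothPoint Y (rationalPoint K a.1) ∧
          zariskiTangentSpace Y a.1 = C a)) := by
  classical
  have hK : IsAlgClosed K := IsAlgClosure.isAlgClosed F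
  refine ⟨?_, fun H hH => ⟨fun b i => ?_, fun a Y hY haY => ?_⟩⟩
  · obtain ⟨V, hV⟩ := exists_submodule_finrank_eq F hk
    -- A code is prescribed at every rational point, so that each one lies on a controlled
    -- component.
    let D : (Fin n → F) → Submodule F (Fin n → F) := fun b => if h : b ∈ S then C ⟨b, h⟩ else V
    have hD : ∀ b, Module.finrank F (D b) = k := by
      intro b
      by_cases h : b ∈ S
      · rw [show D b = C ⟨b, h⟩ from dif_pos h, hC]
      · rw [show D b = V from dif_neg h, hV]
    choose H hH using fun b => exists_matrix_ker_eq (D b) (hD b)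
    let T : Finset (Fin n → F) := Finset.univ
    let G : T → Matrix (Fin (n - k)) (Fin n) F := fun b => H b.1
    have hG : ∀ b : T, Module.finrank F (LinearMap.ker (G b).mulVecLin) = k := by
      intro b
      rw [hH, hD]
    let e := Fintype.equivFin T
    have hY := fun b : T => localVariety_interpolatingPoly (K := K) hk b (hG b)
    refine ⟨_, fun i => localVariety K (e.symm i).1 (interpolatingPoly T G),
      fun i => ⟨(hY _).1, (hY _).2.1, (hY _).2.2.1⟩, fun b => ⟨e ⟨b, Finset.mem_univ b⟩, ?_⟩,
      fun a => ⟨e ⟨a.1, Finset.mem_univ a.1⟩, ?_⟩, fun a i hai => ?_⟩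
    · beta_reduce
      rw [Equiv.symm_apply_apply]
      exact (hY ⟨b, _⟩).2.2.2.1.1
    · beta_reduce
      rw [Equiv.symm_apply_apply]
      exact (hY ⟨a.1, _⟩).2.2.2.1
    · let a' : T := ⟨a.1, Finset.mem_univ a.1⟩
      -- The variety built at another point is a component of the same interpolating variety;
      -- passing through `a`, it must be the one built at `a`.
      have heq := eq_localVariety_of_isIrreducibleComponent hk a' (hG a')
        (isIrreducibleComponent_localVariety hk (e.symm i) (hG (e.symm i))) hai
      beta_reduce
      rw [heq, (hY a').2.2.2.2, hH]
      exact dif_pos a.2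
  · rw [← aeval_map_algebraMap K, aeval_eq_eval, eval_rationalPoint_map,
      eval_interpolatingPoly, map_zero]
  · have hHa : Module.finrank F (LinearMap.ker (H a).mulVecLin) = k := by rw [hH, hC]
    obtain ⟨-, h1, h2, h3, h4⟩ := localVariety_interpolatingPoly (K := K) hk a hHa
    rw [eq_localVariety_of_isIrreducibleComponent hk a hHa hY haY]
    exact ⟨h1, h2, h3, h4.trans (hH a)⟩
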